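/- A (compact, finite) metric graph $\mathsf G$ consists of finitely many vertices and finitely many edges of finite positive length, each edge $\mathsf e$ being identified with an interval $[0,|\mathsf e|]$ whose endpoints are vertices; loops and parallel edges are allowed. Its diameter $D(\mathsf G)$ is the supremum of $\operatorname{dist}(x,y)$ over all points $x,y\in\mathsf G$, where $\operatorname{dist}(x,y)$ is the length of the shortest path in $\mathsf G$ from $x$ to $y$. For $\mathsf G$ connected, $\lambda_1(\mathsf G)>0$ denotes the spectral gap, i.e. the lowest positive eigenvalue of $-\Delta$, where $\Delta$ acts as the second derivative on every edge, on functions which are $H^2$ on every edge, continuous across the vertices, and whose derivatives in the directions pointing out of a vertex sum up to $0$ at every vertex. A pumpkin chain is a connected metric graph without loops, on $V$ vertices, in which exactly $V-2$ vertices are adjacent to exactly two other vertices, exactly two vertices are adjacent to exactly one other vertex, and any two edges joining the same pair of vertices have the same length. Theorem. For every $D>0$ there is a sequence $(\mathsf G_n)_{n\in\mathbb N}$ of pumpkin chains such that $D(\mathsf G_n)=D$ for all $n$ and $\lambda_1(\mathsf G_n)\to\infty$ as $n\to\infty$. Hence the diameter alone gives no upper bound on $\lambda_1$: for every $D>0$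 there is no constant $C$ such that $\lambda_1(\mathsf G)\le C$ for all connected metric graphs $\mathsf G$ with $D(\mathsf G)=D$. -/

import Mathlib

open MeasureTheory Filter Topology

/-- A compact metric graph with finitely many vertices and finitely many edges. Loops and parallel
edges are allowed. The edge `e` is identified with the interval `[0, len e]`, where `0` is the
vertex `src e` and `len e` is the vertex `tgt e`; the orientation serves only as a
parametrisation. -/
structure MetricGraph where
  V : Type
  E : Type
  fintypeV : Fintype V
  fintypeE : Fintype E
  src : E → V
  tgt : E → V
  len : E → ℝ
  len_pos : ∀ e, 0 < len e

namespace MetricGraph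

attribute [instance] MetricGraph.fintypeV MetricGraph.fintypeE

/-- The edge `e` has endpoints `v` and `w`. -/
def Joins (G : MetricGraph) (e : G.E) (v w : G.V) : Prop :=
  (G.src e = v ∧ G.tgt e = w) ∨ (G.src e = w ∧ G.tgt e = v)

/-- The simple graph on the vertices in which two *different* vertices are adjacent if some edge
joins them. -/
def adjGraph (G : MetricGraph) : SimpleGraph G.V where
  Adj v w := v ≠ w ∧ ∃ e, G.Joins e v w
  symm := ⟨fun _ _ h => ⟨h.1.symm, h.2.imp fun _ he => Or.symm he⟩⟩
  loopless := ⟨fun _ h => h.1 rfl⟩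

/-- The metric graph is connected. -/
def IsConnected (G : MetricGraph) : Prop := G.adjGraph.Connected

/-! ### Points, distance, diameter -/

/-- The points of a metric graph: its vertices and the interior points of its edges. -/
inductive Point (G : MetricGraph) : Type
  | vertex (v : G.V) : Point G
  | interior (e : G.E) (x : ℝ) (h0 : 0 < x) (h1 : x < G.len e) : Point G

/-- `G.OnEdge e x p`: the point `p` is the point with coordinate `x` of the edge
`e ≃ [0, len e]`. -/
inductive OnEdge (G : MetricGraph) (e : G.E) : ℝ → G.Point → Prop
  | src : OnEdge G e 0 (.vertex (G.src e))
  | tgt : OnEdge G e (G.len e) (.vertex (G.tgt e))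
  | interior (x : ℝ) (h0 : 0 < x) (h1 : x < G.len e) : OnEdge G e x (.interior e x h0 h1)

/-- `G.HasPath p q L`: there is a path of length `L` from `p` to `q`, consisting of finitely many
segments, each of them contained in an edge. -/
inductive HasPath (G : MetricGraph) (p : G.Point) : G.Point → ℝ → Prop
  | nil : HasPath G p p 0
  | snoc {q r : G.Point} {L : ℝ} {e : G.E} {x y : ℝ} (hL : HasPath G p q L)
      (hq : G.OnEdge e x q) (hr : G.OnEdge e y r) : HasPath G p r (L + |x - y|)

/-- The distance of two points: the length of the shortest path between them. -/
noncomputable def dist (G : MetricGraph) (p q : G.Point) : ℝ := sInf {L | G.HasPath p q L}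

/-- The diameter: the supremum of the distances of all pairs of points (not only of vertices). -/
noncomputable def diam (G : MetricGraph) : ℝ := sSup {d | ∃ p q : G.Point, d = G.dist p q}

/-! ### The Laplacian with natural vertex conditions -/

/-- `f` (as a function on `[0, ℓ]`) is the continuous representative of an element of the Sobolev
space `H¹(0, ℓ)`, with weak derivative `g ∈ L²(0, ℓ)`. -/
def HasSobolevDeriv (ℓ : ℝ) (f g : ℝ → ℝ) : Prop :=
  MemLp g 2 (volume.restrict (Set.Icc 0 ℓ)) ∧
    ∀ x ∈ Set.Icc 0 ℓ, f x = f 0 + ∫ t in (0 : ℝ)..x, g t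

open Classical in
/-- The function on `G` which is given by `u e` on the edge `e ≃ [0, len e]` belongs to the domain
of the Laplacian with natural vertex conditions; `du` and `ddu` are its first and second
derivative. -/
structure InLaplacianDomain (G : MetricGraph) (u du ddu : G.E → ℝ → ℝ) : Prop where
  /-- The function is `H²` on every edge. -/
  deriv_fst : ∀ e, HasSobolevDeriv (G.len e) (u e) (du e)
  deriv_snd : ∀ e, HasSobolevDeriv (G.len e) (du e) (ddu e)
  /-- It is continuous across the vertices. -/
  continuity : ∃ φ : G.V → ℝ, ∀ e, u e 0 = φ (G.src e) ∧ u e (G.len e) = φ (G.tgt e)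
  /-- The derivatives along the edges, directed out of a vertex, sum up to zero. -/
  kirchhoff : ∀ v : G.V, ∑ e, ((if G.src e = v then du e 0 else 0) +
    (if G.tgt e = v then - du e (G.len e) else 0)) = 0

/-- `μ` is an eigenvalue of `-Δ`. -/
def IsEigenvalue (G : MetricGraph) (μ : ℝ) : Prop :=
  ∃ u du ddu : G.E → ℝ → ℝ, G.InLaplacianDomain u du ddu ∧
    (∀ e, ∀ᵐ x ∂(volume.restrict (Set.Icc 0 (G.len e))), - ddu e x = μ * u e x) ∧
    ∃ e, ∃ x ∈ Set.Icc 0 (G.len e), u e x ≠ 0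

/-- The spectral gap `λ₁`: the lowest positive eigenvalue of `-Δ`. -/
noncomputable def spectralGap (G : MetricGraph) : ℝ := sInf {μ | 0 < μ ∧ G.IsEigenvalue μ}

/-! ### Pumpkin chains -/

/-- A pumpkin chain: a connected metric graph without loops in which all vertices but two are
adjacent to exactly two other vertices, the remaining two vertices are adjacent to exactly one
other vertex, and any two parallel edges have the same length. -/
structure IsPumpkinChain (G : MetricGraph) : Prop where
  connected : G.IsConnected
  loopless : ∀ e, G.src e ≠ G.tgt e
  card_two : {v : G.V | (G.adjGraph.neighborSet v).ncard = 2}.ncard + 2 = Fintype.card G.V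
  card_one : {v : G.V | (G.adjGraph.neighborSet v).ncard = 1}.ncard = 2
  len_eq : ∀ v w e f, G.Joins e v w → G.Joins f v w → G.len e = G.len f

end MetricGraph

open intervalIntegral

namespace MetricGraph

/-! ### Paths and distances -/

/-! Take a chain of `N` pumpkins with all edges of length `ℓ = D / N`, the number of parallel edges
growing by a factor 4 from one pumpkin to the next. Parallel edges do not affect distances, so the
diameter is `N * ℓ = D`. They do affect the spectrum: the mass concentrates geometrically towards
the last vertex, so the Poincaré constant is of order `ℓ ^ 2`, independently of `N`.

Quantitatively, an eigenfunction `u` for `μ > 0` has mean zero, so its norm grows when its value `c`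
at the last vertex is subtracted. On each edge, `u - c` splits into an oscillation, bounded by
Cauchy–Schwarz (`HasSobolevDeriv.sq_sub_le`), and the vertex value minus `c`, bounded after
summation by `hardy_geometric`. Each part costs `2 * ℓ ^ 2` times the energy, and the energy is `μ`
times the squared norm. Hence `1 ≤ 4 * ℓ ^ 2 * μ` (`le_of_isEigenvalue`), and the gap is at least `N
^ 2 / (4 * D ^ 2)`. -/

theorem HasPath.trans {G : MetricGraph} {p q r : G.Point} {L M : ℝ} (h : G.HasPath p q L)
    (h' : G.HasPath q r M) : G.HasPath p r (L + M) := by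
  induction h' with
  | nil => simpa using h
  | snoc _ hq hr ih => rw [← add_assoc]; exact ih.snoc hq hr

theorem HasPath.segment {G : MetricGraph} {p q : G.Point} {e : G.E} {x y : ℝ}
    (hp : G.OnEdge e x p) (hq : G.OnEdge e y q) : G.HasPath p q |x - y| := by
  simpa using HasPath.nil.snoc hp hq

theorem HasPath.symm {G : MetricGraph} {p q : G.Point} {L : ℝ} (h : G.HasPath p q L) :
    G.HasPath q p L := by
  induction h with
  | nil => exact .nil
  | snoc _ hq hr ih =>
    rw [add_comm, abs_sub_comm]
    exact (HasPath.segment hr hq).trans ih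

theorem HasPath.nonneg {G : MetricGraph} {p q : G.Point} {L : ℝ} (h : G.HasPath p q L) :
    0 ≤ L := by
  induction h with
  | nil => exact le_rfl
  | snoc _ _ _ ih => positivity

theorem dist_le {G : MetricGraph} {p q : G.Point} {L : ℝ} (h : G.HasPath p q L) :
    G.dist p q ≤ L :=
  csInf_le ⟨0, fun _ h => h.nonneg⟩ h

/-! ### The pumpkin chain with geometrically growing pumpkins -/

/-- The chain of `N` pumpkins, the `k`-th of which consists of `4 ^ (k + 1)` edges of length `ℓ`. -/
def geometricChain (N : ℕ) (ℓ : ℝ) (hℓ : 0 < ℓ) : MetricGraph where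
  V := Fin (N + 1)
  E := Σ k : Fin N, Fin (4 ^ (k.val + 1))
  fintypeV := inferInstance
  fintypeE := inferInstance
  src e := e.1.castSucc
  tgt e := e.1.succ
  len _ := ℓ
  len_pos _ := hℓ

namespace geometricChain

variable {N : ℕ} {ℓ : ℝ} {hℓ : 0 < ℓ}

/-- Adjacency ignores multiplicity, so every combinatorial condition on the chain becomes one on a
path. -/
theorem adjGraph_eq : (geometricChain N ℓ hℓ).adjGraph = SimpleGraph.pathGraph (N + 1) := by
  ext (v : Fin (N + 1)) (w : Fin (N + 1))
  rw [SimpleGraph.pathGraph_adj]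
  constructor
  · rintro ⟨-, e, ⟨rfl, rfl⟩ | ⟨rfl, rfl⟩⟩
    · exact Or.inl rfl
    · exact Or.inr rfl
  · rintro (h | h)
    · refine ⟨fun h' => ?_, ⟨⟨v, by omega⟩, ⟨0, by positivity⟩⟩, Or.inl ⟨rfl, Fin.ext h⟩⟩
      have h'' : v = w := h'
      subst h''; omega
    · refine ⟨fun h' => ?_, ⟨⟨w, by omega⟩, ⟨0, by positivity⟩⟩, Or.inr ⟨rfl, Fin.ext h⟩⟩
      have h'' : v = w := h'
      subst h''; omega

theorem isConnected : (geometricChain N ℓ hℓ).IsConnected := by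
  unfold IsConnected
  rw [adjGraph_eq]
  exact SimpleGraph.pathGraph_connected N

end geometricChain

theorem ncard_neighborSet_pathGraph (N : ℕ) (v : Fin (N + 2)) :
    ((SimpleGraph.pathGraph (N + 2)).neighborSet v).ncard =
      if v = 0 ∨ v = Fin.last (N + 1) then 1 else 2 := by
  split_ifs with h
  · rw [Set.ncard_eq_one]
    rcases h with rfl | rfl
    · refine ⟨1, ?_⟩
      ext w
      simp only [SimpleGraph.mem_neighborSet, SimpleGraph.pathGraph_adj, Set.mem_singleton_iff,
        Fin.ext_iff, Fin.val_zero, Fin.val_one]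
      omega
    · refine ⟨⟨N, by omega⟩, ?_⟩
      ext w
      simp only [SimpleGraph.mem_neighborSet, SimpleGraph.pathGraph_adj, Set.mem_singleton_iff,
        Fin.ext_iff, Fin.val_last]
      omega
  · rw [Set.ncard_eq_two]
    simp only [Fin.ext_iff, Fin.val_zero, Fin.val_last, not_or] at h
    refine ⟨⟨v - 1, by omega⟩, ⟨v + 1, by omega⟩, ?_, ?_⟩
    · simp only [ne_eq, Fin.ext_iff]; omega
    · ext w
      simp only [SimpleGraph.mem_neighborSet, SimpleGraph.pathGraph_adj, Set.mem_insert_iff,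
        Set.mem_singleton_iff, Fin.ext_iff]
      omega

namespace geometricChain

variable {N : ℕ} {ℓ : ℝ} {hℓ : 0 < ℓ}

/-- At least one pumpkin is needed for the two end vertices to be distinct. -/
theorem isPumpkinChain : (geometricChain (N + 1) ℓ hℓ).IsPumpkinChain where
  connected := isConnected
  loopless e h := absurd (congrArg Fin.val (show e.1.castSucc = e.1.succ from h)) (by simp)
  card_two := by
    rw [adjGraph_eq]
    have : {v : Fin (N + 2) | ((SimpleGraph.pathGraph (N + 2)).neighborSet v).ncard = 2} =
        ({0, Fin.last (N + 1)} : Set (Fin (N + 2)))ᶜ := by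
      ext v
      simp only [ncard_neighborSet_pathGraph, Set.mem_ofPred_eq, Set.mem_compl_iff,
        Set.mem_insert_iff, Set.mem_singleton_iff]
      split_ifs with h <;> simp [h]
    have h2 : ({0, Fin.last (N + 1)} : Set (Fin (N + 2))).ncard = 2 :=
      Set.ncard_pair (by simp [Fin.ext_iff])
    have h3 := Set.ncard_add_ncard_compl ({0, Fin.last (N + 1)} : Set (Fin (N + 2)))
    rw [h2, Nat.card_eq_fintype_card] at h3
    rw [add_comm]
    exact (congrArg (fun s : Set (Fin (N + 2)) => 2 + s.ncard) this).trans h3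
  card_one := by
    rw [adjGraph_eq]
    have : {v : Fin (N + 2) | ((SimpleGraph.pathGraph (N + 2)).neighborSet v).ncard = 1} =
        ({0, Fin.last (N + 1)} : Set (Fin (N + 2))) := by
      ext v
      simp only [ncard_neighborSet_pathGraph, Set.mem_ofPred_eq,
        Set.mem_insert_iff, Set.mem_singleton_iff]
      split_ifs with h <;> simp [h]
    exact (congrArg Set.ncard this).trans (Set.ncard_pair (by simp [Fin.ext_iff]))
  len_eq _ _ _ _ _ _ := rfl

/-! ### The diameter -/

/-- The distance of a point to the first vertex. -/
def height : (geometricChain N ℓ hℓ).Point → ℝ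
  | .vertex v => (show Fin (N + 1) from v).val * ℓ
  | .interior e x _ _ => e.1.val * ℓ + x

theorem height_of_onEdge {e : (geometricChain N ℓ hℓ).E} {x : ℝ}
    {p : (geometricChain N ℓ hℓ).Point} (h : (geometricChain N ℓ hℓ).OnEdge e x p) :
    height p = e.1.val * ℓ + x := by
  cases h with
  | src => exact (add_zero _).symm
  | tgt =>
    change ((e.1.val + 1 : ℕ) : ℝ) * ℓ = e.1.val * ℓ + ℓ
    push_cast; ring
  | interior => rfl

/-- Within an edge, height differs from the coordinate by a constant, so no segment changes it by
more than its length. This gives the lower bound on distances. -/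
theorem abs_height_sub_le {p q : (geometricChain N ℓ hℓ).Point} {L : ℝ}
    (h : (geometricChain N ℓ hℓ).HasPath p q L) : |height p - height q| ≤ L := by
  induction h with
  | nil => simp
  | @snoc q r L e x y hL hq hr ih =>
    have h1 := height_of_onEdge hq
    have h2 := height_of_onEdge hr
    have h3 : height q - height r = x - y := by rw [h1, h2]; ring
    calc |height p - height r| = |(height p - height q) + (x - y)| := by rw [← h3]; ring_nf
      _ ≤ |height p - height q| + |x - y| := abs_add_le _ _
      _ ≤ L + |x - y| := by gcongr

theorem hasPath_vertex (i : ℕ) (hi : i < N + 1) (j : ℕ) (hj : i + j < N + 1) :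
    (geometricChain N ℓ hℓ).HasPath (.vertex (⟨i, hi⟩ : Fin (N + 1)))
      (.vertex (⟨i + j, hj⟩ : Fin (N + 1))) (j * ℓ) := by
  induction j with
  | zero => simpa using HasPath.nil
  | succ j ih =>
    have := (ih (by omega)).snoc
      (OnEdge.src (G := geometricChain N ℓ hℓ) (e := ⟨⟨i + j, by omega⟩, ⟨0, by positivity⟩⟩))
      OnEdge.tgt
    have h : ((j + 1 : ℕ) : ℝ) * ℓ = j * ℓ + |0 - ℓ| := by
      rw [zero_sub, abs_neg, abs_of_pos hℓ]
      push_cast; ring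
    rw [h]
    exact this

theorem hasPath_zero (p : (geometricChain N ℓ hℓ).Point) :
    (geometricChain N ℓ hℓ).HasPath p (.vertex (0 : Fin (N + 1))) (height p) := by
  have key (v : Fin (N + 1)) : (geometricChain N ℓ hℓ).HasPath (.vertex v)
      (.vertex (0 : Fin (N + 1))) (v.val * ℓ) := by
    have := (hasPath_vertex (N := N) (hℓ := hℓ) 0 (by omega) v.val (by omega)).symm
    simp only [zero_add] at this
    exact this
  cases p with
  | vertex v => exact key v
  | interior e x h0 h1 =>
    have h := (HasPath.segment (OnEdge.interior x h0 h1) OnEdge.src).trans (key e.1.castSucc)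
    have h2 : height (Point.interior e x h0 h1) = |x - 0| + e.1.castSucc.val * ℓ := by
      rw [sub_zero, abs_of_pos h0, add_comm]
      rfl
    rw [h2]
    exact h

theorem hasPath_last (p : (geometricChain N ℓ hℓ).Point) :
    (geometricChain N ℓ hℓ).HasPath p (.vertex (Fin.last N)) (N * ℓ - height p) := by
  have key (v : Fin (N + 1)) : (geometricChain N ℓ hℓ).HasPath (.vertex v)
      (.vertex (Fin.last N)) (N * ℓ - v.val * ℓ) := by
    have := hasPath_vertex (hℓ := hℓ) v.val v.isLt (N - v.val) (by omega)
    have h2 : (⟨v.val + (N - v.val), by omega⟩ : Fin (N + 1)) = Fin.last N :=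
      Fin.ext (by simp only [Fin.val_last]; omega)
    rw [h2, Nat.cast_sub (by omega), sub_mul] at this
    exact this
  cases p with
  | vertex v => exact key v
  | interior e x h0 h1 =>
    have h1' : x < ℓ := h1
    have h := (HasPath.segment (OnEdge.interior x h0 h1) OnEdge.tgt).trans (key e.1.succ)
    have h2 : N * ℓ - height (Point.interior e x h0 h1) =
        |x - ℓ| + (N * ℓ - e.1.succ.val * ℓ) := by
      rw [abs_of_neg (by linarith)]
      change N * ℓ - (e.1.val * ℓ + x) = _
      rw [Fin.val_succ]
      push_cast; ring
    rw [h2]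
    exact h

theorem diam_eq : (geometricChain N ℓ hℓ).diam = N * ℓ := by
  have upper (p q : (geometricChain N ℓ hℓ).Point) : (geometricChain N ℓ hℓ).dist p q ≤ N * ℓ := by
    -- The routes through the first and the last vertex have total length `2 * N * ℓ`, so the
    -- shorter one has length at most `N * ℓ`.
    have h1 := dist_le ((hasPath_zero p).trans (hasPath_zero q).symm)
    have h2 := dist_le ((hasPath_last p).trans (hasPath_last q).symm)
    linarith
  have lower : (geometricChain N ℓ hℓ).dist (.vertex (0 : Fin (N + 1))) (.vertex (Fin.last N)) =
      N * ℓ := by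
    refine le_antisymm (upper _ _) (le_csInf ⟨_, hasPath_last _⟩ fun L hL => ?_)
    have := abs_height_sub_le hL
    have h2 : height (hℓ := hℓ) (.vertex (0 : Fin (N + 1))) - height (hℓ := hℓ)
        (.vertex (Fin.last N)) = -(N * ℓ) := by
      change ((0 : ℕ) : ℝ) * ℓ - (N : ℝ) * ℓ = _
      simp
    rw [h2, abs_neg] at this
    exact (le_abs_self _).trans this
  refine le_antisymm (csSup_le ⟨_, _, _, lower.symm⟩ ?_) (le_csSup ⟨N * ℓ, ?_⟩ ⟨_, _, lower.symm⟩)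
  · rintro _ ⟨p, q, rfl⟩
    exact upper p q
  · rintro _ ⟨p, q, rfl⟩
    exact upper p q

end geometricChain

/-! ### One-dimensional Sobolev functions -/

theorem HasSobolevDeriv.intervalIntegrable {ℓ : ℝ} {f g : ℝ → ℝ} (h : HasSobolevDeriv ℓ f g)
    (hℓ : 0 ≤ ℓ) : IntervalIntegrable g volume 0 ℓ := by
  rw [intervalIntegrable_iff_integrableOn_Icc_of_le hℓ]
  exact h.1.integrable (by norm_num)

theorem HasSobolevDeriv.continuousOn {ℓ : ℝ} {f g : ℝ → ℝ} (h : HasSobolevDeriv ℓ f g)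
    (hℓ : 0 ≤ ℓ) : ContinuousOn f (Set.Icc 0 ℓ) := by
  have h1 : ContinuousOn (fun x => ∫ t in (0 : ℝ)..x, g t) (Set.Icc 0 ℓ) := by
    have := continuousOn_primitive_interval (f := g) (μ := volume) (a := 0) (b := ℓ)
      (by rw [Set.uIcc_of_le hℓ]; exact h.1.integrable (by norm_num))
    rwa [Set.uIcc_of_le hℓ] at this
  exact (continuousOn_const.add h1).congr h.2

/-- A weak derivative with a continuous representative is a classical one. For `du` the
representative is `-(μ * u)`, as the eigenvalue equation holds only almost everywhere. -/
theorem HasSobolevDeriv.hasDerivAt {ℓ : ℝ} {f g g' : ℝ → ℝ} (h : HasSobolevDeriv ℓ f g)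
    (hg : ContinuousOn g' (Set.Icc 0 ℓ)) (hgg' : g =ᵐ[volume.restrict (Set.Icc 0 ℓ)] g')
    {x : ℝ} (hx : x ∈ Set.Ioo 0 ℓ) : HasDerivAt f (g' x) x := by
  have hℓ : 0 ≤ ℓ := (hx.1.trans hx.2).le
  have hcx : ContinuousAt g' x := hg.continuousAt (Icc_mem_nhds hx.1 hx.2)
  have hint : IntervalIntegrable g' volume 0 x :=
    (hg.mono (by rw [Set.uIcc_of_le hx.1.le]; exact Set.Icc_subset_Icc_right hx.2.le)).intervalIntegrable
  have hd : HasDerivAt (fun y => f 0 + ∫ t in (0 : ℝ)..y, g' t) (g' x) x :=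
    (integral_hasDerivAt_right hint
      ((hg.mono Set.Ioo_subset_Icc_self).stronglyMeasurableAtFilter isOpen_Ioo x hx) hcx).const_add _
  refine hd.congr_of_eventuallyEq ?_
  filter_upwards [Icc_mem_nhds hx.1 hx.2] with y hy
  rw [h.2 y hy]
  congr 1
  refine integral_congr_ae ?_
  rw [Set.uIoc_of_le hy.1]
  have := (ae_restrict_iff' measurableSet_Icc).1 hgg'
  filter_upwards [this] with t ht ht'
  exact ht ⟨ht'.1.le, ht'.2.trans hy.2⟩

theorem hasSobolevDeriv_of_hasDerivAt {ℓ : ℝ} {f g : ℝ → ℝ} (hg : Continuous g)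
    (h : ∀ x, HasDerivAt f (g x) x) : HasSobolevDeriv ℓ f g := by
  refine ⟨?_, fun x _ => ?_⟩
  · obtain ⟨C, hC⟩ := isCompact_Icc.exists_bound_of_continuousOn (s := Set.Icc 0 ℓ) hg.continuousOn
    refine MemLp.of_bound hg.aestronglyMeasurable C ?_
    exact (ae_restrict_iff' measurableSet_Icc).2 (Eventually.of_forall hC)
  · rw [integral_eq_sub_of_hasDerivAt (fun y _ => h y) (hg.intervalIntegrable _ _)]
    ring

/-- The Cauchy–Schwarz inequality against the constant function. -/
theorem sq_integral_le {a b : ℝ} (hab : a ≤ b) {g : ℝ → ℝ} (hg : ContinuousOn g (Set.Icc a b)) :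
    (∫ t in a..b, g t) ^ 2 ≤ (b - a) * ∫ t in a..b, g t ^ 2 := by
  rcases hab.eq_or_lt with rfl | hab'
  · simp
  rw [← Set.uIcc_of_le hab] at hg
  set I := ∫ t in a..b, g t with hI
  set J := ∫ t in a..b, g t ^ 2 with hJ
  -- Expanded, this integral is `(b - a) * ((b - a) * J - I ^ 2)`.
  have h1 : 0 ≤ ∫ t in a..b, ((b - a) * g t - I) ^ 2 := integral_nonneg hab fun _ _ => sq_nonneg _
  have h2 : ∫ t in a..b, ((b - a) * g t - I) ^ 2 = (b - a) ^ 2 * J - (b - a) * I ^ 2 := by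
    have : ∀ t, ((b - a) * g t - I) ^ 2 =
      (b - a) ^ 2 * g t ^ 2 - 2 * (b - a) * I * g t + I ^ 2 := fun t => by ring
    simp_rw [this]
    rw [intervalIntegral.integral_add, intervalIntegral.integral_sub, intervalIntegral.integral_const_mul,
      intervalIntegral.integral_const_mul, intervalIntegral.integral_const, ← hI, ← hJ, smul_eq_mul]
    · ring
    all_goals exact ContinuousOn.intervalIntegrable (by fun_prop)
  rw [h2] at h1
  have h3 : 0 < b - a := sub_pos.2 hab'
  have h4 : 0 ≤ (b - a) * ((b - a) * J - I ^ 2) := by linarith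
  linarith [nonneg_of_mul_nonneg_right h4 h3]

/-- For `f` with derivative `g`, the oscillation to the right endpoint is controlled by the
energy. -/
theorem HasSobolevDeriv.sq_sub_le {ℓ : ℝ} {f g : ℝ → ℝ} (h : HasSobolevDeriv ℓ f g)
    (hg : ContinuousOn g (Set.Icc 0 ℓ)) {x : ℝ} (hx : x ∈ Set.Icc 0 ℓ) :
    (f x - f ℓ) ^ 2 ≤ ℓ * ∫ t in (0 : ℝ)..ℓ, g t ^ 2 := by
  have hℓ : 0 ≤ ℓ := hx.1.trans hx.2
  have hi := h.intervalIntegrable hℓ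
  have hi1 : IntervalIntegrable g volume 0 x :=
    hi.mono_set (by rw [Set.uIcc_of_le hx.1, Set.uIcc_of_le hℓ]; exact Set.Icc_subset_Icc_right hx.2)
  have e : f x - f ℓ = -∫ t in x..ℓ, g t := by
    rw [h.2 x hx, h.2 ℓ ⟨hℓ, le_rfl⟩, ← integral_interval_sub_left hi hi1]
    ring
  have hg' : ContinuousOn g (Set.Icc x ℓ) := hg.mono (Set.Icc_subset_Icc_left hx.1)
  rw [e, neg_sq]
  refine (sq_integral_le hx.2 hg').trans ?_
  have hsq : IntervalIntegrable (fun t => g t ^ 2) volume 0 ℓ :=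
    ContinuousOn.intervalIntegrable (by rw [Set.uIcc_of_le hℓ]; fun_prop)
  have h1 : ∫ t in x..ℓ, g t ^ 2 ≤ ∫ t in (0 : ℝ)..ℓ, g t ^ 2 :=
    integral_mono_interval hx.1 hx.2 le_rfl (Eventually.of_forall fun _ => sq_nonneg _) hsq
  have h2 : 0 ≤ ∫ t in x..ℓ, g t ^ 2 := integral_nonneg hx.2 fun _ _ => sq_nonneg _
  exact mul_le_mul (by linarith [hx.1]) h1 h2 hℓ

/-! ### Eigenfunctions -/

section Eigenfunction

variable {G : MetricGraph} {μ : ℝ} {u du ddu : G.E → ℝ → ℝ}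

theorem InLaplacianDomain.continuousOn (h : G.InLaplacianDomain u du ddu) (e : G.E) :
    ContinuousOn (u e) (Set.Icc 0 (G.len e)) :=
  (h.deriv_fst e).continuousOn (G.len_pos e).le

theorem InLaplacianDomain.continuousOn_deriv (h : G.InLaplacianDomain u du ddu) (e : G.E) :
    ContinuousOn (du e) (Set.Icc 0 (G.len e)) :=
  (h.deriv_snd e).continuousOn (G.len_pos e).le

open Classical in
/-- A function that is continuous across the vertices has vanishing total flux. -/
theorem InLaplacianDomain.sum_flux (h : G.InLaplacianDomain u du ddu) (φ : G.V → ℝ) :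
    ∑ e, (φ (G.tgt e) * du e (G.len e) - φ (G.src e) * du e 0) = 0 := by
  -- Weight the Kirchhoff conditions by `φ`; exchanging the sums leaves the two endpoint terms of
  -- each edge.
  have h1 : ∑ v, φ v * ∑ e, ((if G.src e = v then du e 0 else 0) +
      (if G.tgt e = v then - du e (G.len e) else 0)) = 0 :=
    Finset.sum_eq_zero fun v _ => by rw [h.kirchhoff v, mul_zero]
  simp_rw [Finset.mul_sum] at h1
  rw [Finset.sum_comm] at h1
  refine neg_eq_zero.1 (Eq.trans ?_ h1)
  rw [← Finset.sum_neg_distrib]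
  refine Finset.sum_congr rfl fun e _ => ?_
  simp only [mul_add, mul_ite, mul_zero, Finset.sum_add_distrib, Finset.sum_ite_eq,
    Finset.mem_univ, if_true]
  ring

theorem InLaplacianDomain.hasDerivAt (h : G.InLaplacianDomain u du ddu) (e : G.E) {x : ℝ}
    (hx : x ∈ Set.Ioo 0 (G.len e)) : HasDerivAt (u e) (du e x) x :=
  (h.deriv_fst e).hasDerivAt (h.continuousOn_deriv e) EventuallyEq.rfl hx

theorem InLaplacianDomain.hasDerivAt_deriv (h : G.InLaplacianDomain u du ddu) (e : G.E)
    (hμ : ∀ᵐ x ∂(volume.restrict (Set.Icc 0 (G.len e))), - ddu e x = μ * u e x) {x : ℝ}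
    (hx : x ∈ Set.Ioo 0 (G.len e)) : HasDerivAt (du e) (-(μ * u e x)) x := by
  have hc := h.continuousOn e
  refine (h.deriv_snd e).hasDerivAt (g' := fun x => -(μ * u e x)) (by fun_prop) ?_ hx
  filter_upwards [hμ] with t ht
  linarith

theorem InLaplacianDomain.integral_eigenfunction (h : G.InLaplacianDomain u du ddu) (e : G.E)
    (hμ : ∀ᵐ x ∂(volume.restrict (Set.Icc 0 (G.len e))), - ddu e x = μ * u e x) :
    μ * ∫ x in (0 : ℝ)..G.len e, u e x = -(du e (G.len e) - du e 0) := by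
  have hl := (G.len_pos e).le
  have hc := h.continuousOn e
  rw [← integral_eq_sub_of_hasDerivAt_of_le hl (h.continuousOn_deriv e)
    (fun x hx => h.hasDerivAt_deriv e hμ hx)
    (ContinuousOn.intervalIntegrable (by rw [Set.uIcc_of_le hl]; fun_prop)),
    intervalIntegral.integral_neg, neg_neg, intervalIntegral.integral_const_mul]

theorem InLaplacianDomain.integral_sq_eigenfunction (h : G.InLaplacianDomain u du ddu) (e : G.E)
    (hμ : ∀ᵐ x ∂(volume.restrict (Set.Icc 0 (G.len e))), - ddu e x = μ * u e x) :
    (∫ x in (0 : ℝ)..G.len e, du e x ^ 2) - μ * ∫ x in (0 : ℝ)..G.len e, u e x ^ 2 =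
      u e (G.len e) * du e (G.len e) - u e 0 * du e 0 := by
  have hl := (G.len_pos e).le
  have hc := h.continuousOn e
  have hd := h.continuousOn_deriv e
  rw [← intervalIntegral.integral_const_mul, ← intervalIntegral.integral_sub]
  · refine integral_eq_sub_of_hasDerivAt_of_le (f := fun x => u e x * du e x) hl (hc.mul hd)
      (fun x hx => ?_) (ContinuousOn.intervalIntegrable (by rw [Set.uIcc_of_le hl]; fun_prop))
    refine ((h.hasDerivAt e hx).mul (h.hasDerivAt_deriv e hμ hx)).congr_deriv ?_
    ring
  all_goals exact ContinuousOn.intervalIntegrable (by rw [Set.uIcc_of_le hl]; fun_prop)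

/-- The flux identity tested with the constant 1. -/
theorem InLaplacianDomain.sum_integral_eq_zero (h : G.InLaplacianDomain u du ddu)
    (hμ : ∀ e, ∀ᵐ x ∂(volume.restrict (Set.Icc 0 (G.len e))), - ddu e x = μ * u e x)
    (hμ0 : μ ≠ 0) :
    ∑ e, ∫ x in (0 : ℝ)..G.len e, u e x = 0 := by
  have h1 := h.sum_flux fun _ => 1
  simp only [one_mul] at h1
  refine (mul_eq_zero.1 ?_).resolve_left hμ0
  refine neg_eq_zero.1 (Eq.trans ?_ h1)
  rw [Finset.mul_sum, ← Finset.sum_neg_distrib]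
  exact Finset.sum_congr rfl fun e _ => by rw [h.integral_eigenfunction e (hμ e), neg_neg]

/-- Green's identity: the boundary terms are the flux tested with the vertex values of `u` itself.
-/
theorem InLaplacianDomain.sum_integral_sq (h : G.InLaplacianDomain u du ddu)
    (hμ : ∀ e, ∀ᵐ x ∂(volume.restrict (Set.Icc 0 (G.len e))), - ddu e x = μ * u e x) :
    μ * ∑ e, ∫ x in (0 : ℝ)..G.len e, u e x ^ 2 = ∑ e, ∫ x in (0 : ℝ)..G.len e, du e x ^ 2 := by
  obtain ⟨φ, hφ⟩ := h.continuity
  have h1 := h.sum_flux φ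
  refine (sub_eq_zero.1 (Eq.trans ?_ h1)).symm
  rw [Finset.mul_sum, ← Finset.sum_sub_distrib]
  refine Finset.sum_congr rfl fun e _ => ?_
  rw [h.integral_sq_eigenfunction e (hμ e), (hφ e).1, (hφ e).2]

/-- Since an eigenfunction has mean zero, subtracting a constant increases its norm. -/
theorem InLaplacianDomain.sum_integral_sq_le (h : G.InLaplacianDomain u du ddu)
    (hμ : ∀ e, ∀ᵐ x ∂(volume.restrict (Set.Icc 0 (G.len e))), - ddu e x = μ * u e x)
    (hμ0 : μ ≠ 0) (c : ℝ) :
    ∑ e, ∫ x in (0 : ℝ)..G.len e, u e x ^ 2 ≤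
      ∑ e, ∫ x in (0 : ℝ)..G.len e, (u e x - c) ^ 2 := by
  have key : ∀ e, ∫ x in (0 : ℝ)..G.len e, (u e x - c) ^ 2 =
      (∫ x in (0 : ℝ)..G.len e, u e x ^ 2) - 2 * c * (∫ x in (0 : ℝ)..G.len e, u e x) +
        G.len e * c ^ 2 := by
    intro e
    have hl := (G.len_pos e).le
    have hc := h.continuousOn e
    have : ∀ x, (u e x - c) ^ 2 = u e x ^ 2 - 2 * c * u e x + c ^ 2 := fun x => by ring
    simp_rw [this]
    rw [intervalIntegral.integral_add, intervalIntegral.integral_sub, intervalIntegral.integral_const_mul,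
      intervalIntegral.integral_const, smul_eq_mul, sub_zero]
    all_goals exact ContinuousOn.intervalIntegrable (by rw [Set.uIcc_of_le hl]; fun_prop)
  simp_rw [key]
  rw [Finset.sum_add_distrib, Finset.sum_sub_distrib, ← Finset.mul_sum,
    h.sum_integral_eq_zero hμ hμ0, mul_zero, sub_zero]
  exact le_add_of_nonneg_right
    (Finset.sum_nonneg fun e _ => mul_nonneg (G.len_pos e).le (sq_nonneg c))

end Eigenfunction

/-! ### The spectral gap of the chain -/

/-- A discrete Hardy inequality with geometric weights. -/
theorem hardy_geometric (N : ℕ) (a : Fin (N + 1) → ℝ) (ha : a (Fin.last N) = 0) :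
    ∑ k : Fin N, (4 : ℝ) ^ k.val * a k.succ ^ 2 + a 0 ^ 2 / 2 ≤
      ∑ k : Fin N, (4 : ℝ) ^ k.val * (a k.castSucc - a k.succ) ^ 2 := by
  induction N with
  | zero =>
    have : a 0 = 0 := ha
    simp [this]
  | succ N ih =>
    have := ih (fun k => a k.succ) ha
    rw [Fin.sum_univ_succ, Fin.sum_univ_succ (n := N)]
    simp only [Fin.val_zero, pow_zero, one_mul, Fin.val_succ, pow_succ', mul_assoc,
      ← Finset.mul_sum, Fin.castSucc_zero, Fin.castSucc_succ] at this ⊢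
    -- Four times the induction hypothesis leaves exactly `0 ≤ (a 0 - 2 * a 1) ^ 2 / 2`. The
    -- boundary term `a 0 ^ 2 / 2` in the statement is what lets the induction close.
    nlinarith [sq_nonneg (a 0 - 2 * a (Fin.succ 0))]

namespace geometricChain

variable {N : ℕ} {ℓ : ℝ} {hℓ : 0 < ℓ}

theorem le_of_isEigenvalue {μ : ℝ} (hμ0 : 0 < μ)
    (hμ : (geometricChain N ℓ hℓ).IsEigenvalue μ) : 1 ≤ 4 * ℓ ^ 2 * μ := by
  obtain ⟨u, du, ddu, h, hE, e₀, x₀, hx₀, hne⟩ := hμ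
  obtain ⟨φ, hφ⟩ := h.continuity
  replace hφ : ∀ e : (Σ k : Fin N, Fin (4 ^ (k.val + 1))),
    u e 0 = φ e.1.castSucc ∧ u e ℓ = φ e.1.succ := hφ
  -- With this constant, `φ - c` vanishes at the last vertex, as the Hardy inequality requires.
  let c : ℝ := φ (Fin.last N)
  have H1 : ∑ e, ∫ x in (0 : ℝ)..ℓ, u e x ^ 2 ≤ ∑ e, ∫ x in (0 : ℝ)..ℓ, (u e x - c) ^ 2 :=
    h.sum_integral_sq_le hE hμ0.ne' c
  have H2 : μ * ∑ e, ∫ x in (0 : ℝ)..ℓ, u e x ^ 2 = ∑ e, ∫ x in (0 : ℝ)..ℓ, du e x ^ 2 :=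
    h.sum_integral_sq hE
  have hosc : ∀ e, ∀ x ∈ Set.Icc 0 ℓ, (u e x - u e ℓ) ^ 2 ≤ ℓ * ∫ t in (0 : ℝ)..ℓ, du e t ^ 2 :=
    fun e x hx => (h.deriv_fst e).sq_sub_le (h.continuousOn_deriv e) hx
  have hcont : ∀ e, ContinuousOn (u e) (Set.Icc 0 ℓ) := h.continuousOn
  have H3 : ∀ e : (geometricChain N ℓ hℓ).E, ∫ x in (0 : ℝ)..ℓ, (u e x - c) ^ 2 ≤
      2 * ℓ * (φ e.1.succ - c) ^ 2 + 2 * ℓ ^ 2 * ∫ t in (0 : ℝ)..ℓ, du e t ^ 2 := by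
    intro e
    have hc := hcont e
    calc ∫ x in (0 : ℝ)..ℓ, (u e x - c) ^ 2
        ≤ ∫ x in (0 : ℝ)..ℓ, (2 * (φ e.1.succ - c) ^ 2 +
            2 * (ℓ * ∫ t in (0 : ℝ)..ℓ, du e t ^ 2)) := by
          refine integral_mono_on hℓ.le
            (ContinuousOn.intervalIntegrable (by rw [Set.uIcc_of_le hℓ.le]; fun_prop))
            intervalIntegrable_const fun x hx => ?_
          have := hosc e x hx
          rw [(hφ e).2] at this
          nlinarith [sq_nonneg ((u e x - φ e.1.succ) - (φ e.1.succ - c))]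
      _ = _ := by
          rw [intervalIntegral.integral_const, smul_eq_mul]
          ring
  have H4 : ∑ e : (geometricChain N ℓ hℓ).E, (φ e.1.succ - c) ^ 2 ≤
      ℓ * ∑ e, ∫ t in (0 : ℝ)..ℓ, du e t ^ 2 := by
    -- Summing over the `4 ^ (k + 1)` edges of each pumpkin produces the Hardy weights, up to a
    -- common factor 4.
    have hardy := hardy_geometric N (fun k => φ k - c) (sub_self _)
    have h1 : ∑ e : (geometricChain N ℓ hℓ).E, (φ e.1.succ - c) ^ 2 =
        4 * ∑ k : Fin N, (4 : ℝ) ^ k.val * (φ k.succ - c) ^ 2 := by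
      refine (Fintype.sum_sigma _).trans ?_
      rw [Finset.mul_sum]
      refine Finset.sum_congr rfl fun k _ => ?_
      simp [pow_succ']
      ring
    have h2 : ∑ e : (geometricChain N ℓ hℓ).E, (φ e.1.castSucc - φ e.1.succ) ^ 2 =
        4 * ∑ k : Fin N, (4 : ℝ) ^ k.val * (φ k.castSucc - φ k.succ) ^ 2 := by
      refine (Fintype.sum_sigma _).trans ?_
      rw [Finset.mul_sum]
      refine Finset.sum_congr rfl fun k _ => ?_
      simp [pow_succ']
      ring
    have h3 : ∑ e : (geometricChain N ℓ hℓ).E, (φ e.1.castSucc - φ e.1.succ) ^ 2 ≤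
        ℓ * ∑ e, ∫ t in (0 : ℝ)..ℓ, du e t ^ 2 := by
      rw [Finset.mul_sum]
      refine Finset.sum_le_sum fun e _ => ?_
      rw [← (hφ e).1, ← (hφ e).2]
      exact hosc e 0 ⟨le_rfl, hℓ.le⟩
    simp only [sub_sub_sub_cancel_right] at hardy
    have h4 := sq_nonneg (φ (0 : Fin (N + 1)) - c)
    linarith
  have H5 : ∑ e, ∫ x in (0 : ℝ)..ℓ, (u e x - c) ^ 2 ≤
      4 * ℓ ^ 2 * ∑ e, ∫ t in (0 : ℝ)..ℓ, du e t ^ 2 := by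
    have h1 := Finset.sum_le_sum fun e (_ : e ∈ Finset.univ) => H3 e
    rw [Finset.sum_add_distrib, ← Finset.mul_sum, ← Finset.mul_sum] at h1
    have h2 := mul_le_mul_of_nonneg_left H4 (by positivity : 0 ≤ 2 * ℓ)
    refine h1.trans ((add_le_add_left h2 _).trans_eq ?_)
    ring
  have H6 : 0 < ∑ e, ∫ x in (0 : ℝ)..ℓ, u e x ^ 2 := by
    refine Finset.sum_pos' (fun e _ => integral_nonneg hℓ.le fun _ _ => sq_nonneg _)
      ⟨e₀, Finset.mem_univ _, integral_pos hℓ ((hcont e₀).pow 2) (fun _ _ => sq_nonneg _)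
        ⟨x₀, hx₀, by positivity⟩⟩
  rw [← H2] at H5
  have H7 : 1 * (∑ e, ∫ x in (0 : ℝ)..ℓ, u e x ^ 2) ≤
      (4 * ℓ ^ 2 * μ) * ∑ e, ∫ x in (0 : ℝ)..ℓ, u e x ^ 2 := by linarith
  exact le_of_mul_le_mul_right H7 H6

/-- Opposite sine waves on two parallel edges form an eigenfunction. -/
theorem isEigenvalue : (geometricChain (N + 1) ℓ hℓ).IsEigenvalue ((Real.pi / ℓ) ^ 2) := by
  let b : ℝ := Real.pi / ℓ
  have hb : b * ℓ = Real.pi := div_mul_cancel₀ _ hℓ.ne'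
  -- Two edges of the first pumpkin. The sine vanishes at both ends, which gives continuity; the
  -- opposite signs cancel the slopes at both shared vertices.
  let e₁ : (Σ k : Fin (N + 1), Fin (4 ^ (k.val + 1))) := ⟨0, ⟨0, by simp⟩⟩
  let e₂ : (Σ k : Fin (N + 1), Fin (4 ^ (k.val + 1))) := ⟨0, ⟨1, by simp⟩⟩
  have he : e₂ ≠ e₁ := fun h => by
    have : (1 : ℕ) = 0 := congrArg (fun e => e.2.val) h
    omega
  let s : (Σ k : Fin (N + 1), Fin (4 ^ (k.val + 1))) → ℝ :=
    fun e => if e = e₁ then 1 else if e = e₂ then -1 else 0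
  refine ⟨fun e x => s e * Real.sin (b * x), fun e x => s e * (b * Real.cos (b * x)),
    fun e x => s e * (-(b ^ 2 * Real.sin (b * x))), ⟨fun e => ?_, fun e => ?_, ?_, ?_⟩, fun e => ?_,
    e₁, ℓ / 2, ?_, ?_⟩
  · refine hasSobolevDeriv_of_hasDerivAt (by fun_prop) fun x => HasDerivAt.const_mul _ ?_
    have := ((hasDerivAt_id' x).const_mul b).sin
    simpa [mul_comm] using this
  · refine hasSobolevDeriv_of_hasDerivAt (by fun_prop) fun x => HasDerivAt.const_mul _ ?_
    have := (((hasDerivAt_id' x).const_mul b).cos).const_mul b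
    convert this using 1
    ring
  · refine ⟨fun _ => 0, fun e => ⟨by simp, ?_⟩⟩
    change s e * Real.sin (b * ℓ) = 0
    simp [hb]
  · intro v
    classical
    change ∑ e : (Σ k : Fin (N + 1), Fin (4 ^ (k.val + 1))),
      ((if e.1.castSucc = v then s e * (b * Real.cos (b * 0)) else 0) +
      (if e.1.succ = v then -(s e * (b * Real.cos (b * ℓ))) else 0)) = 0
    rw [Finset.sum_eq_add e₁ e₂ he.symm]
    · have h1 : s e₁ = 1 := if_pos rfl
      have h2 : s e₂ = -1 := by simp [s, he]
      rw [h1, h2]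
      change ((if (0 : Fin (N + 1)).castSucc = v then _ else 0) +
        (if (0 : Fin (N + 1)).succ = v then _ else 0)) +
        ((if (0 : Fin (N + 1)).castSucc = v then _ else 0) +
        (if (0 : Fin (N + 1)).succ = v then _ else 0)) = 0
      split_ifs <;> ring
    · rintro e - ⟨h1, h2⟩
      simp [s, h1, h2]
    · simp
    · simp
  · exact Eventually.of_forall fun x => by ring
  · exact ⟨by positivity, by change ℓ / 2 ≤ ℓ; linarith⟩
  · have h1 : s e₁ = 1 := if_pos rfl
    have h2 : b * (ℓ / 2) = Real.pi / 2 := by linarith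
    simp [h1, h2]

theorem le_spectralGap : 1 / (4 * ℓ ^ 2) ≤ (geometricChain (N + 1) ℓ hℓ).spectralGap := by
  -- An explicit positive eigenvalue is needed: the infimum of the empty set would be 0.
  refine le_csInf ⟨_, by have := Real.pi_pos; positivity, isEigenvalue⟩ fun μ hμ => ?_
  rw [div_le_iff₀' (by positivity)]
  exact le_of_isEigenvalue hμ.1 hμ.2

end geometricChain

end MetricGraph

theorem mainTheorem2 (D : ℝ) (hD : 0 < D) :
    (∃ G : ℕ → MetricGraph,
      (∀ n, (G n).IsPumpkinChain ∧ (G n).diam = D) ∧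
      Tendsto (fun n => (G n).spectralGap) atTop atTop) ∧
    ¬ ∃ C : ℝ, ∀ G : MetricGraph, G.IsConnected → G.diam = D → G.spectralGap ≤ C := by
  have key : ∃ G : ℕ → MetricGraph,
      (∀ n, (G n).IsPumpkinChain ∧ (G n).diam = D) ∧
      Tendsto (fun n => (G n).spectralGap) atTop atTop := by
    -- With `n + 1` pumpkins the gap is at least `(n + 1) ^ 2 / (4 * D ^ 2)`.
    refine ⟨fun n => .geometricChain (n + 1) (D / ((n + 1 : ℕ) : ℝ)) (by positivity),
      fun n => ⟨MetricGraph.geometricChain.isPumpkinChain, ?_⟩, ?_⟩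
    · rw [MetricGraph.geometricChain.diam_eq]
      exact mul_div_cancel₀ _ (by positivity)
    · refine tendsto_atTop_mono (fun n => MetricGraph.geometricChain.le_spectralGap) ?_
      have h : ∀ n : ℕ, 1 / (4 * (D / ((n + 1 : ℕ) : ℝ)) ^ 2) =
          1 / (4 * D ^ 2) * ((n + 1 : ℕ) : ℝ) ^ 2 := fun n => by field_simp
      simp_rw [h]
      refine Tendsto.const_mul_atTop (by positivity) ?_
      exact (tendsto_pow_atTop two_ne_zero).comp
        (tendsto_natCast_atTop_atTop.comp (tendsto_add_atTop_nat 1))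
  refine ⟨key, ?_⟩
  rintro ⟨C, hC⟩
  obtain ⟨G, hG, hlim⟩ := key
  obtain ⟨n, hn⟩ := (hlim.eventually_gt_atTop C).exists
  exact (hC (G n) (hG n).1.connected (hG n).2).not_gt hn
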